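/- Let $f:X\to S$ be a continuous map of topological spaces which is locally topologically trivial over $S$, with fibers $X_t=f^{-1}(t)$. Let $H_j$ and $H^j$ denote singular homology and cohomology with $\mathbf{Q}$-coefficients, let $\langle\ ,\ \rangle: H^j(A)\times H_j(A)\to\mathbf{Q}$ be the canonical pairing (the value of a cocycle on a cycle), and assume that $H_j(X_t)$ and $H^j(X_t)$ are finite dimensional for all $t\in S$ and all $j\ge 0$. Let $s\in S$, let $\gamma:[0,1]\to S$ be a loop based at $s$, and let $\rho:Y=[0,1]\times_S X\to[0,1]$ be the base change of $f$ by $\gamma$, with fibers $Y_u=\rho^{-1}(u)$, so that $Y_0=X_s=Y_1$. A geometric monodromy of $\gamma$ is a homeomorphism $\gamma_\#:X_s=Y_0\simeq Y_1=X_s$ induced by a trivialization $Y\simeq[0,1]\times F$ over $[0,1]$; it induces $\gamma_*$ on $H_j(X_s)$ and $\gamma^*$ on $H^j(X_s)$. The groups $H_j(Y_u)$ form a local system on $[0,1]$, whose sections are the families $a_u\in H_j(Y_u)$ such that each point of $[0,1]$ has an open neighborhood $U$ for which the image of $a_u$ in $H_j(\rho^{-1}(U))$ is the same for all $u\in U$.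 The groups $H^j(Y_u)$ form a local system on $[0,1]$, whose sections are the families $a_u\in H^j(Y_u)$ such that each point of $[0,1]$ has an open neighborhood $U$ and a class in $H^j(\rho^{-1}(U))$ which restricts to $a_u$ for all $u\in U$. The local system monodromies $\gamma_h$ on $H_j(X_s)$ and $\gamma_c$ on $H^j(X_s)$ are the maps that send the value at $0$ of each section over $[0,1]$ to its value at $1$, via $Y_0=X_s=Y_1$. Then a geometric monodromy of $\gamma$ exists. For every $j\ge 0$ the pairing between $H^j(X_s)$ and $H_j(X_s)$ is perfect, and $\gamma_h\in\mathrm{Aut}(H_j(X_s))$ and $\gamma_c\in\mathrm{Aut}(H^j(X_s))$ are well defined and satisfy $$\langle\gamma_c x,\gamma_h y\rangle=\langle x,y\rangle\qquad\text{for all }x\in H^j(X_s),\ y\in H_j(X_s).$$ For every choice of the geometric monodromy $\gamma_\#$ one has $$\gamma_*=\gamma_h,\qquad \gamma^*=\gamma_c^{-1},\qquad \gamma^*={}^t\gamma_*,$$ where the last equality means $\langle\gamma^*x,y\rangle=\langle x,\gamma_*y\rangle$ for all $x\in H^j(X_s)$, $y\in H_j(X_s)$. -/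

import Mathlib

open CategoryTheory Topology unitInterval

universe u v

noncomputable section

namespace Monodromy

/-! ### Singular homology and cohomology with rational coefficients, and their pairing -/

/-- The coefficient module `ℚ`, placed in the universe of the spaces under consideration. -/
abbrev coeff : ModuleCat.{u} ℚ := ModuleCat.of ℚ (ULift.{u} ℚ)

/-- The complex of rational singular chains, as a functor. -/
abbrev chains : TopCat.{u} ⥤ ChainComplex (ModuleCat.{u} ℚ) ℕ :=
  (AlgebraicTopology.singularChainComplexFunctor (ModuleCat.{u} ℚ)).obj coeff

/-- The complex of rational singular cochains `Hom(C_•(A), ℚ)`. -/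
abbrev cochains (A : TopCat.{u}) : CochainComplex (ModuleCat.{u} ℚ) ℕ :=
  (chains.obj A).linearYonedaObj ℚ coeff

/-- The map of singular cochain complexes given by precomposition with the map of chains. -/
def cochainsMap {A B : TopCat.{u}} (φ : A ⟶ B) : cochains B ⟶ cochains A where
  f n := ((linearYoneda ℚ (ModuleCat.{u} ℚ)).obj coeff).map ((chains.map φ).f n).op
  comm' i j _ := by
    change ((linearYoneda ℚ (ModuleCat.{u} ℚ)).obj coeff).map _ ≫
        ((linearYoneda ℚ (ModuleCat.{u} ℚ)).obj coeff).map _ =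
      ((linearYoneda ℚ (ModuleCat.{u} ℚ)).obj coeff).map _ ≫
        ((linearYoneda ℚ (ModuleCat.{u} ℚ)).obj coeff).map _
    rw [← Functor.map_comp, ← Functor.map_comp, ← op_comp, ← op_comp,
      (chains.map φ).comm]

/-- Singular homology `H_j(A; ℚ)`. -/
abbrev H (j : ℕ) (A : Type u) [TopologicalSpace A] : ModuleCat.{u} ℚ :=
  ((AlgebraicTopology.singularHomologyFunctor (ModuleCat.{u} ℚ) j).obj coeff).obj (TopCat.of A)

/-- Singular cohomology `H^j(A; ℚ)`. -/
abbrev coH (j : ℕ) (A : Type u) [TopologicalSpace A] : ModuleCat.{u} ℚ :=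
  (cochains (TopCat.of A)).homology j

variable {A B : Type u} [TopologicalSpace A] [TopologicalSpace B]

/-- The map `φ_* : H_j(A) → H_j(B)` induced by a continuous map. -/
def push (j : ℕ) (φ : C(A, B)) : H j A →ₗ[ℚ] H j B :=
  (((AlgebraicTopology.singularHomologyFunctor (ModuleCat.{u} ℚ) j).obj coeff).map
    (TopCat.ofHom φ)).hom

/-- The map `φ^* : H^j(B) → H^j(A)` induced by a continuous map. -/
def pull (j : ℕ) (φ : C(A, B)) : coH j B →ₗ[ℚ] coH j A :=
  (HomologicalComplex.homologyMap (cochainsMap (TopCat.ofHom φ)) j).hom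

/-- The cochain underlying a cocycle. -/
def cocycleHom (j : ℕ) (A : TopCat.{u}) :
    (cochains A).cycles j →ₗ[ℚ] ((chains.obj A).X j ⟶ coeff.{u}) :=
  ((cochains A).iCycles j).hom

lemma d_comp_cocycleHom (j : ℕ) (A : TopCat.{u}) (z : (cochains A).cycles j) :
    (chains.obj A).d (j + 1) j ≫ cocycleHom j A z = 0 := by
  have h := (cochains A).iCycles_d j (j + 1)
  exact congrArg (fun m => m.hom z) h

/-- A cocycle, as a linear form on homology: it sends the class of a cycle to the value of the
cocycle on that cycle. -/
def cocycleEval (j : ℕ) (A : TopCat.{u}) (z : (cochains A).cycles j) :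
    (chains.obj A).homology j ⟶ coeff.{u} :=
  (chains.obj A).homologyι j ≫
    (chains.obj A).descOpcycles (cocycleHom j A z) (j + 1) (by simp) (d_comp_cocycleHom j A z)

lemma homologyπ_comp_cocycleEval (j : ℕ) (A : TopCat.{u}) (z : (cochains A).cycles j) :
    (chains.obj A).homologyπ j ≫ cocycleEval j A z =
      (chains.obj A).iCycles j ≫ cocycleHom j A z := by
  simp [cocycleEval]

/-- `cocycleEval` as a linear map to the rational dual of homology. -/
def cocyclePairing (j : ℕ) (A : TopCat.{u}) :
    (cochains A).cycles j →ₗ[ℚ] Module.Dual ℚ ((chains.obj A).homology j) where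
  toFun z := ULift.moduleEquiv.toLinearMap ∘ₗ (cocycleEval j A z).hom
  map_add' z w := by
    have : cocycleEval j A (z + w) = cocycleEval j A z + cocycleEval j A w := by
      rw [← cancel_epi ((chains.obj A).homologyπ j)]
      simp [homologyπ_comp_cocycleEval, Preadditive.comp_add]
    rw [this]; ext; rfl
  map_smul' c z := by
    have : cocycleEval j A (c • z) = c • cocycleEval j A z := by
      rw [← cancel_epi ((chains.obj A).homologyπ j)]
      simp [homologyπ_comp_cocycleEval, Linear.comp_smul]
    rw [this]; ext; rfl

lemma toCycles_comp_cocyclePairing (i j : ℕ) (A : TopCat.{u}) :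
    (cochains A).toCycles i j ≫ ModuleCat.ofHom (cocyclePairing j A) = 0 := by
  ext ψ : 2
  have h1 : cocycleHom j A (((cochains A).toCycles i j).hom ψ) =
      (chains.obj A).d j i ≫ (show (chains.obj A).X i ⟶ coeff.{u} from ψ) :=
    congrArg (fun m => m.hom ψ) ((cochains A).toCycles_i i j)
  have h2 : cocycleEval j A (((cochains A).toCycles i j).hom ψ) = 0 := by
    rw [← cancel_epi ((chains.obj A).homologyπ j), homologyπ_comp_cocycleEval, h1,
      HomologicalComplex.iCycles_d_assoc, Limits.zero_comp, Limits.comp_zero]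
  change ULift.moduleEquiv.toLinearMap ∘ₗ
    (cocycleEval j A (((cochains A).toCycles i j).hom ψ)).hom = 0
  rw [h2]; ext; rfl

/-- The canonical pairing `⟨·, ·⟩ : H^j(A) × H_j(A) → ℚ`, the value of a cocycle on a cycle. -/
def pairing (j : ℕ) (A : Type u) [TopologicalSpace A] :
    coH j A →ₗ[ℚ] H j A →ₗ[ℚ] ℚ :=
  (((cochains (TopCat.of A)).sc j).descHomology
    (ModuleCat.ofHom (cocyclePairing j (TopCat.of A)))
    (toCycles_comp_cocyclePairing _ j (TopCat.of A))).hom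

/-- The pairing of the class of a cocycle with the class of a cycle. -/
lemma pairing_apply (j : ℕ) (A : Type u) [TopologicalSpace A]
    (z : (cochains (TopCat.of A)).cycles j) (c : (chains.obj (TopCat.of A)).cycles j) :
    pairing j A (((cochains (TopCat.of A)).homologyπ j).hom z)
        (((chains.obj (TopCat.of A)).homologyπ j).hom c) =
      ((cocycleHom j (TopCat.of A) z).hom (((chains.obj (TopCat.of A)).iCycles j).hom c)).down := by
  have h1 : pairing j A (((cochains (TopCat.of A)).homologyπ j).hom z) =
      cocyclePairing j (TopCat.of A) z :=
    congrArg (fun m => m.hom z) (((cochains (TopCat.of A)).sc j).π_descHomology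
      (ModuleCat.ofHom (cocyclePairing j (TopCat.of A)))
      (toCycles_comp_cocyclePairing _ j (TopCat.of A)))
  rw [h1]
  exact congrArg (fun m => (m.hom c).down) (homologyπ_comp_cocycleEval j (TopCat.of A) z)

/-! ### Locally trivial maps and base change by a loop -/

/-- The fiber of a map over a point, with the subspace topology. -/
abbrev Fiber {X : Type u} {S : Type v} (f : X → S) (s : S) : Type u := f ⁻¹' {s}

/-- `f : X → S` is locally topologically trivial: each point `s` of `S` has an open neighborhood
over which `f` is a product with fiber `f ⁻¹ (s)`. The fibers over different connected components
of `S` may differ. -/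
def IsLocallyTrivial {X : Type u} {S : Type v} [TopologicalSpace X] [TopologicalSpace S]
    (f : X → S) : Prop :=
  ∀ s : S, ∃ e : Bundle.Trivialization (Fiber f s) f, s ∈ e.baseSet

section Loop

variable {X : Type u} {S : Type v} [TopologicalSpace X] [TopologicalSpace S]
  (f : X → S) {s : S} (γ : Path s s)

/-- The base change `Y = [0,1] ×_S X` of `f` by `γ`. -/
abbrev BaseChange : Type u := {p : I × X // γ p.1 = f p.2}

/-- The projection `ρ : Y → [0,1]`. -/
def proj (y : BaseChange f γ) : I := y.1.1

/-- The identification `X_s = Y_t` for a parameter `t` with `γ t = s`. -/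
def fiberIdent (t : I) (ht : γ t = s) : Fiber f s ≃ₜ Fiber (proj f γ) t where
  toFun x := ⟨⟨(t, x.1), ht.trans x.2.symm⟩, rfl⟩
  invFun y := ⟨y.1.1.2, by
    have h1 : y.1.1.1 = t := y.2
    have h2 := y.1.2
    rw [h1, ht] at h2
    exact h2.symm⟩
  left_inv x := rfl
  right_inv y := Subtype.ext (Subtype.ext (Prod.ext (Eq.symm y.2) rfl))
  continuous_toFun := by fun_prop
  continuous_invFun := by fun_prop

/-- The identification `X_s = Y_0`. -/
abbrev identZero : Fiber f s ≃ₜ Fiber (proj f γ) 0 := fiberIdent f γ 0 γ.source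

/-- The identification `X_s = Y_1`. -/
abbrev identOne : Fiber f s ≃ₜ Fiber (proj f γ) 1 := fiberIdent f γ 1 γ.target

/-- `g` is a geometric monodromy `γ_#` of `f` along `γ`: it is the homeomorphism
`X_s = Y_0 ≃ Y_1 = X_s` given by some trivialization `Φ : Y ≃ [0,1] × F` over `[0,1]`. -/
def IsGeometricMonodromy (g : Fiber f s ≃ₜ Fiber f s) : Prop :=
  ∃ (F : Type u) (_ : TopologicalSpace F) (Φ : BaseChange f γ ≃ₜ I × F),
    (∀ y, (Φ y).1 = proj f γ y) ∧
    ∀ x, (Φ (identOne f γ (g x)).1).2 = (Φ (identZero f γ x).1).2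

end Loop

/-! ### The local systems of homology and cohomology groups of the fibers -/

section LocalSystem

variable {Y : Type u} {T : Type v} [TopologicalSpace Y] [TopologicalSpace T] (ρ : Y → T)

/-- The inclusion of the fiber `Y_t` into `ρ ⁻¹ (U)`, for `t ∈ U`. -/
def fiberIncl (U : Set T) (t : T) (ht : t ∈ U) : C(Fiber ρ t, ρ ⁻¹' U) where
  toFun y := ⟨y.1, by
    have h : ρ y.1 = t := y.2
    simpa [h] using ht⟩
  continuous_toFun := by fun_prop

/-- Sections of the local system `{H_j(Y_t)}`: families of classes which, near each point of the
base, have the same image in the homology of the part of `Y` over a neighborhood. -/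
def IsHomologySection (j : ℕ) (a : ∀ t : T, H j (Fiber ρ t)) : Prop :=
  ∀ t₀ : T, ∃ U : Set T, IsOpen U ∧ t₀ ∈ U ∧ ∃ c : H j (ρ ⁻¹' U),
    ∀ (t : T) (ht : t ∈ U), push j (fiberIncl ρ U t ht) (a t) = c

/-- Sections of the local system `{H^j(Y_t)}`: families of classes which, near each point of the
base, are the restrictions of one class on the part of `Y` over a neighborhood. -/
def IsCohomologySection (j : ℕ) (a : ∀ t : T, coH j (Fiber ρ t)) : Prop :=
  ∀ t₀ : T, ∃ U : Set T, IsOpen U ∧ t₀ ∈ U ∧ ∃ c : coH j (ρ ⁻¹' U),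
    ∀ (t : T) (ht : t ∈ U), a t = pull j (fiberIncl ρ U t ht) c

end LocalSystem

section LocalSystemMonodromy

variable {X : Type u} {S : Type v} [TopologicalSpace X] [TopologicalSpace S]
  (f : X → S) {s : S} (γ : Path s s)

/-- `γh` is the monodromy `H_j(X_s) = H_j(Y_0) ≃ H_j(Y_1) = H_j(X_s)` of the local system
`{H_j(Y_t)}` on `[0,1]`: `γh x = x'` exactly when a section of the local system over `[0,1]` goes
from `x` at `0` to `x'` at `1`. There is at most one such `γh`. -/
def IsHomologyMonodromy (j : ℕ) (γh : H j (Fiber f s) ≃ₗ[ℚ] H j (Fiber f s)) : Prop :=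
  ∀ x x', γh x = x' ↔ ∃ a : ∀ t : I, H j (Fiber (proj f γ) t), IsHomologySection (proj f γ) j a ∧
    a 0 = push j (identZero f γ : C(Fiber f s, Fiber (proj f γ) 0)) x ∧
    a 1 = push j (identOne f γ : C(Fiber f s, Fiber (proj f γ) 1)) x'

/-- `γc` is the monodromy `H^j(X_s) = H^j(Y_0) ≃ H^j(Y_1) = H^j(X_s)` of the local system
`{H^j(Y_t)}` on `[0,1]`: `γc x = x'` exactly when a section of the local system over `[0,1]` goes
from `x` at `0` to `x'` at `1`. There is at most one such `γc`. -/
def IsCohomologyMonodromy (j : ℕ) (γc : coH j (Fiber f s) ≃ₗ[ℚ] coH j (Fiber f s)) : Prop :=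
  ∀ x x', γc x = x' ↔
    ∃ a : ∀ t : I, coH j (Fiber (proj f γ) t), IsCohomologySection (proj f γ) j a ∧
    pull j (identZero f γ : C(Fiber f s, Fiber (proj f γ) 0)) (a 0) = x ∧
    pull j (identOne f γ : C(Fiber f s, Fiber (proj f γ) 1)) (a 1) = x'

end LocalSystemMonodromy

end Monodromy

end

noncomputable section

/-! Over $[0,1]$ the family $Y$ is a product: local trivializations glue along a subdivision of the
interval (`exists_baseChange_homeomorph`). After choosing $Y\simeq[0,1]\times F$, the sections of
both local systems are the constant families with values in $H_j(F)$ and $H^j(F)$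
(`isHomologySection_iff`, `isCohomologySection_iff`). Transport from $Y_0$ to $Y_1$ is therefore the
identity of $F$ read through the trivialization, which is $g_*$ on homology and $(g^*)^{-1}$ on
cohomology for the geometric monodromy $g$. The section relations do not mention the trivialization,
so every geometric monodromy induces the same maps.

The rest is duality: $g^*$ and $g_*$ are adjoint at the level of chains (`pairing_pull`), and the
pairing identifies $H^j$ with the dual of $H_j$ because linear forms extend over a field
(`pairing_injective`, `pairing_surjective`). Invariance of the pairing is the adjunction with $g^*$
moved to the other side. -/

/-- Over a field, a linear map which vanishes on the kernel of `f` factors through `f`. -/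
lemma LinearMap.exists_comp_eq_of_ker_le_ker {K V W U : Type*} [DivisionRing K]
    [AddCommGroup V] [Module K V] [AddCommGroup W] [Module K W] [AddCommGroup U] [Module K U]
    (f : V →ₗ[K] W) (g : V →ₗ[K] U) (h : LinearMap.ker f ≤ LinearMap.ker g) :
    ∃ k : W →ₗ[K] U, k ∘ₗ f = g := by
  obtain ⟨r, hr⟩ := ((LinearMap.ker f).liftQ f le_rfl).exists_leftInverse_of_injective
    (Submodule.ker_liftQ_eq_bot' _ _ rfl)
  refine ⟨(LinearMap.ker f).liftQ g h ∘ₗ r, LinearMap.ext fun x => ?_⟩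
  have hx : r (f x) = (LinearMap.ker f).mkQ x := LinearMap.congr_fun hr ((LinearMap.ker f).mkQ x)
  simp [hx]

namespace Monodromy

variable {A B C : Type u} [TopologicalSpace A] [TopologicalSpace B] [TopologicalSpace C]

/-! ### Functoriality, homotopy invariance and duality -/

lemma push_id (j : ℕ) (x : H j A) : push j (ContinuousMap.id A) x = x :=
  congrArg (fun m => m.hom x) (CategoryTheory.Functor.map_id
    ((AlgebraicTopology.singularHomologyFunctor (ModuleCat.{u} ℚ) j).obj coeff) (TopCat.of A))

lemma push_push (j : ℕ) (ψ : C(B, C)) (φ : C(A, B)) (x : H j A) :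
    push j ψ (push j φ x) = push j (ψ.comp φ) x :=
  (congrArg (fun m => m.hom x) (CategoryTheory.Functor.map_comp
    ((AlgebraicTopology.singularHomologyFunctor (ModuleCat.{u} ℚ) j).obj coeff)
    (TopCat.ofHom φ) (TopCat.ofHom ψ))).symm

/-- Homotopic maps induce the same map on homology. -/
lemma push_congr (j : ℕ) {φ ψ : C(A, B)} (h : φ.Homotopic ψ) : push j φ = push j ψ := by
  obtain ⟨h⟩ := h
  have e := TopCat.Homotopy.congr_homologyMap_singularChainComplexFunctor
    (f := TopCat.ofHom φ) (g := TopCat.ofHom ψ) h coeff.{u} j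
  exact congrArg ModuleCat.Hom.hom e

/-- The maps induced on homology and cohomology are adjoint for the canonical pairing. -/
lemma pairing_pull (j : ℕ) (φ : C(A, B)) (x : coH j B) (y : H j A) :
    pairing j A (pull j φ x) y = pairing j B x (push j φ y) := by
  obtain ⟨z, rfl⟩ := (ModuleCat.epi_iff_surjective
    ((cochains (TopCat.of B)).homologyπ j)).1 inferInstance x
  obtain ⟨c, rfl⟩ := (ModuleCat.epi_iff_surjective
    ((chains.obj (TopCat.of A)).homologyπ j)).1 inferInstance y
  have h1 : pull j φ (((cochains (TopCat.of B)).homologyπ j).hom z) =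
      ((cochains (TopCat.of A)).homologyπ j).hom
        ((HomologicalComplex.cyclesMap (cochainsMap (TopCat.ofHom φ)) j).hom z) :=
    congrArg (fun m => m.hom z)
      (HomologicalComplex.homologyπ_naturality (cochainsMap (TopCat.ofHom φ)) j)
  have h2 : push j φ (((chains.obj (TopCat.of A)).homologyπ j).hom c) =
      ((chains.obj (TopCat.of B)).homologyπ j).hom
        ((HomologicalComplex.cyclesMap (chains.map (TopCat.ofHom φ)) j).hom c) :=
    congrArg (fun m => m.hom c)
      (HomologicalComplex.homologyπ_naturality (chains.map (TopCat.ofHom φ)) j)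
  have h3 : cocycleHom j (TopCat.of A)
        ((HomologicalComplex.cyclesMap (cochainsMap (TopCat.ofHom φ)) j).hom z) =
      (chains.map (TopCat.ofHom φ)).f j ≫ cocycleHom j (TopCat.of B) z :=
    congrArg (fun m => m.hom z)
      (HomologicalComplex.cyclesMap_i (cochainsMap (TopCat.ofHom φ)) j)
  have h4 : ((chains.obj (TopCat.of B)).iCycles j).hom
        ((HomologicalComplex.cyclesMap (chains.map (TopCat.ofHom φ)) j).hom c) =
      ((chains.map (TopCat.ofHom φ)).f j).hom (((chains.obj (TopCat.of A)).iCycles j).hom c) :=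
    congrArg (fun m => m.hom c)
      (HomologicalComplex.cyclesMap_i (chains.map (TopCat.ofHom φ)) j)
  erw [h1, h2, pairing_apply, pairing_apply, h3, h4]
  rfl

/-- A cohomology class is determined by its values on homology classes. -/
lemma pairing_injective (j : ℕ) (A : Type u) [TopologicalSpace A] :
    Function.Injective (pairing j A) := by
  rw [injective_iff_map_eq_zero]
  intro x hx
  obtain ⟨z, rfl⟩ := (ModuleCat.epi_iff_surjective
    ((cochains (TopCat.of A)).homologyπ j)).1 inferInstance x
  set K := chains.obj (TopCat.of A)
  -- For `j = 0` the default value is `i = 0`, with zero differential, so degree zero needs no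
  -- separate argument.
  let i := (ComplexShape.down ℕ).next j
  have hker : LinearMap.ker (K.d j i).hom ≤ LinearMap.ker (cocycleHom j (TopCat.of A) z).hom := by
    intro c hc
    let l : ModuleCat.of ℚ (LinearMap.ker (K.d j i).hom) ⟶ K.cycles j :=
      K.liftCycles (ModuleCat.ofHom (Submodule.subtype _)) i rfl (by ext w; exact w.2)
    have hl : (K.iCycles j).hom (l.hom ⟨c, hc⟩) = c :=
      congrArg (fun m : ModuleCat.of ℚ (LinearMap.ker (K.d j i).hom) ⟶ K.X j => m.hom ⟨c, hc⟩)
        (K.liftCycles_i _ i rfl _)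
    have h := pairing_apply j A z (l.hom ⟨c, hc⟩)
    rw [hx] at h
    erw [hl] at h
    exact ULift.down_injective h.symm
  -- A cocycle vanishing on all cycles factors through the boundary map, so it is the coboundary of
  -- `k`.
  obtain ⟨k, hk⟩ := LinearMap.exists_comp_eq_of_ker_le_ker _ _ hker
  have hz : ((cochains (TopCat.of A)).toCycles i j).hom (ModuleCat.ofHom k) = z := by
    apply (ModuleCat.mono_iff_injective ((cochains (TopCat.of A)).iCycles j)).1 inferInstance
    have h1 : cocycleHom j (TopCat.of A)
        (((cochains (TopCat.of A)).toCycles i j).hom (ModuleCat.ofHom k)) =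
        K.d j i ≫ ModuleCat.ofHom k :=
      congrArg (fun m => m.hom (ModuleCat.ofHom k)) ((cochains (TopCat.of A)).toCycles_i i j)
    exact h1.trans (ModuleCat.hom_ext hk)
  rw [← hz]
  exact congrArg (fun m => m.hom (ModuleCat.ofHom k))
    ((cochains (TopCat.of A)).toCycles_comp_homologyπ i j)

/-- Every linear form on homology is given by a cohomology class. -/
lemma pairing_surjective (j : ℕ) (A : Type u) [TopologicalSpace A] :
    Function.Surjective (pairing j A) := by
  intro l
  set K := chains.obj (TopCat.of A)
  -- A retraction of chains onto cycles extends the form `l` from cycles to a cochain `ψ`; it is a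
  -- cocycle because boundaries have zero homology class.
  obtain ⟨r, hr⟩ := (K.iCycles j).hom.exists_leftInverse_of_injective
    (LinearMap.ker_eq_bot.2 ((ModuleCat.mono_iff_injective (K.iCycles j)).1 inferInstance))
  let ψ : K.X j ⟶ coeff.{u} :=
    ModuleCat.ofHom (ULift.moduleEquiv.symm.toLinearMap ∘ₗ l ∘ₗ (K.homologyπ j).hom ∘ₗ r)
  have hψ : ∀ c, ψ.hom ((K.iCycles j).hom c) = ULift.up (l ((K.homologyπ j).hom c)) := by
    intro c
    have h : r ((K.iCycles j).hom c) = c := LinearMap.congr_fun hr c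
    change ULift.up (l ((K.homologyπ j).hom (r ((K.iCycles j).hom c)))) = _
    rw [h]
  have hd : K.d (j + 1) j ≫ ψ = 0 := by
    rw [← K.toCycles_i (j + 1) j, Category.assoc]
    ext c : 2
    have h : (K.homologyπ j).hom ((K.toCycles (j + 1) j).hom c) = 0 :=
      congrArg (fun m => m.hom c) (K.toCycles_comp_homologyπ (j + 1) j)
    exact (hψ _).trans (congrArg ULift.up ((congrArg l h).trans (map_zero l)))
  -- Encoding `ψ` as the map `c ↦ c • ψ` allows the universal property of cycles to be applied;
  -- evaluation at 1 recovers `ψ`.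
  let w : ModuleCat.of ℚ (ULift.{u} ℚ) ⟶ (cochains (TopCat.of A)).X j :=
    ModuleCat.ofHom ((LinearMap.toSpanSingleton ℚ (K.X j ⟶ coeff.{u}) ψ) ∘ₗ
      ULift.moduleEquiv.toLinearMap)
  have hw : w ≫ (cochains (TopCat.of A)).d j (j + 1) = 0 := by
    ext c : 2
    change K.d (j + 1) j ≫ (c.down • ψ) = 0
    rw [Linear.comp_smul, hd, smul_zero]
  let z := ((cochains (TopCat.of A)).liftCycles w (j + 1) (by simp) hw).hom ⟨1⟩
  have hz : cocycleHom j (TopCat.of A) z = ψ := by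
    have h : cocycleHom j (TopCat.of A) z = (1 : ℚ) • ψ :=
      congrArg (fun m => m.hom ⟨1⟩)
        ((cochains (TopCat.of A)).liftCycles_i w (j + 1) (by simp) hw)
    rw [h, one_smul]
  refine ⟨((cochains (TopCat.of A)).homologyπ j).hom z, LinearMap.ext fun y => ?_⟩
  obtain ⟨c, rfl⟩ := (ModuleCat.epi_iff_surjective (K.homologyπ j)).1 inferInstance y
  refine (pairing_apply j A z c).trans ?_
  rw [hz]
  exact congrArg ULift.down (hψ c)

/-- Since classes are detected by the pairing, adjunction with `push` transfers functoriality and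
homotopy invariance from homology to cohomology. -/
lemma pull_id (j : ℕ) (x : coH j A) : pull j (ContinuousMap.id A) x = x :=
  pairing_injective j A (LinearMap.ext fun y => by rw [pairing_pull, push_id])

lemma pull_pull (j : ℕ) (φ : C(A, B)) (ψ : C(B, C)) (x : coH j C) :
    pull j φ (pull j ψ x) = pull j (ψ.comp φ) x :=
  pairing_injective j A (LinearMap.ext fun y => by simp only [pairing_pull, push_push])

/-- Homotopic maps induce the same map on cohomology. -/
lemma pull_congr (j : ℕ) {φ ψ : C(A, B)} (h : φ.Homotopic ψ) : pull j φ = pull j ψ :=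
  LinearMap.ext fun x => pairing_injective j A (LinearMap.ext fun y => by
    rw [pairing_pull, pairing_pull, push_congr j h])

/-- The isomorphism `g_*` of homology induced by a homeomorphism. -/
def pushEquiv (j : ℕ) (g : A ≃ₜ B) : H j A ≃ₗ[ℚ] H j B :=
  LinearEquiv.ofLinearMap (push j (g : C(A, B))) (push j (g.symm : C(B, A)))
    (LinearMap.ext fun x => by simp [push_push, push_id])
    (LinearMap.ext fun x => by simp [push_push, push_id])

/-- The isomorphism `g^*` of cohomology induced by a homeomorphism. -/
def pullEquiv (j : ℕ) (g : A ≃ₜ B) : coH j B ≃ₗ[ℚ] coH j A :=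
  LinearEquiv.ofLinearMap (pull j (g : C(A, B))) (pull j (g.symm : C(B, A)))
    (LinearMap.ext fun x => by simp [pull_pull, pull_id])
    (LinearMap.ext fun x => by simp [pull_pull, pull_id])

lemma pairing_pullEquiv_symm_pushEquiv (j : ℕ) (g : A ≃ₜ B) (x : coH j A) (y : H j A) :
    pairing j B ((pullEquiv j g).symm x) (pushEquiv j g y) = pairing j A x y := by
  obtain ⟨x, rfl⟩ := (pullEquiv j g).surjective x
  rw [LinearEquiv.symm_apply_apply]
  exact (pairing_pull j (g : C(A, B)) x y).symm

/-! ### Sections of the local systems of a trivialized family over an interval -/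

/-- The segment from `t₀` to `t` stays in $[0,1]$ by convexity and never gets farther from `t₀` than
`t` is. -/
lemma joinedIn_of_ball_subset {U : Set I} {t₀ t : I} {ε : ℝ} (hU : Metric.ball t₀ ε ⊆ U)
    (ht : t ∈ Metric.ball t₀ ε) : JoinedIn U t₀ t := by
  refine ⟨⟨⟨fun τ => ⟨t₀ + τ * (t - t₀), ?_, ?_⟩, by fun_prop⟩, by ext; simp, by ext; simp⟩,
    fun τ => hU ?_⟩
  · nlinarith [mul_nonneg τ.2.1 t.2.1, mul_nonneg (sub_nonneg.2 τ.2.2) t₀.2.1]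
  · nlinarith [mul_nonneg τ.2.1 (sub_nonneg.2 t.2.2),
      mul_nonneg (sub_nonneg.2 τ.2.2) (sub_nonneg.2 t₀.2.2)]
  · rw [Metric.mem_ball, Subtype.dist_eq, Real.dist_eq] at ht ⊢
    have h : |(τ : ℝ) * (t - t₀)| ≤ |(t : ℝ) - t₀| := by
      rw [abs_mul, abs_of_nonneg τ.2.1]
      exact mul_le_of_le_one_left (abs_nonneg _) τ.2.2
    simpa using h.trans_lt ht

section Trivialized

variable {Y F : Type u} [TopologicalSpace Y] [TopologicalSpace F] {ρ : Y → I}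
  (Φ : Y ≃ₜ I × F) (hΦ : ∀ y, (Φ y).1 = ρ y)

/-- The projection to `F` of the fiber over `t` of a family trivialized by `Φ`. -/
def fiberToModel (ρ : Y → I) (Φ : Y ≃ₜ I × F) (t : I) : C(Fiber ρ t, F) where
  toFun y := (Φ y.1).2

include hΦ in
lemma proj_trivialization_symm (p : I × F) : ρ (Φ.symm p) = p.1 := by
  rw [← hΦ, Φ.apply_symm_apply]

/-- The inclusion of `F` as the fiber over `t` of a family trivialized by `Φ`. -/
def modelToFiber (t : I) : C(F, Fiber ρ t) where
  toFun x := ⟨Φ.symm (t, x), proj_trivialization_symm Φ hΦ (t, x)⟩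

lemma fiberToModel_comp_modelToFiber (t : I) :
    (fiberToModel ρ Φ t).comp (modelToFiber Φ hΦ t) = ContinuousMap.id F := by
  ext x
  simp [fiberToModel, modelToFiber]

lemma modelToFiber_comp_fiberToModel (t : I) :
    (modelToFiber Φ hΦ t).comp (fiberToModel ρ Φ t) = ContinuousMap.id (Fiber ρ t) := by
  ext y
  have h : (t, (Φ y.1).2) = Φ y.1 := Prod.ext (((hΦ y.1).trans y.2).symm) rfl
  simp [fiberToModel, modelToFiber, h]

/-- The inclusions of `F` as the fibers over two points of a path component of `U` are homotopic
in `ρ ⁻¹ (U)`. -/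
lemma homotopic_fiberIncl_comp_modelToFiber {U : Set I} {t t' : I} (h : JoinedIn U t t') :
    ((fiberIncl ρ U t h.source_mem).comp (modelToFiber Φ hΦ t)).Homotopic
      ((fiberIncl ρ U t' h.target_mem).comp (modelToFiber Φ hΦ t')) :=
  ⟨{ toFun := fun p => ⟨Φ.symm (h.somePath p.1, p.2), by
        rw [Set.mem_preimage, proj_trivialization_symm Φ hΦ]
        exact h.somePath_mem p.1⟩
     continuous_toFun := by fun_prop
     map_zero_left := fun x => by simp [fiberIncl, modelToFiber]
     map_one_left := fun x => by simp [fiberIncl, modelToFiber] }⟩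

include hΦ in
/-- The sections of the homology local system of a trivialized family are the constant families. -/
lemma isHomologySection_iff (j : ℕ) (a : ∀ t : I, H j (Fiber ρ t)) :
    IsHomologySection ρ j a ↔
      ∃ b : H j F, ∀ t, a t = push j (modelToFiber Φ hΦ t) b := by
  constructor
  · intro ha
    have hloc : IsLocallyConstant fun t => push j (fiberToModel ρ Φ t) (a t) := by
      rw [IsLocallyConstant.iff_eventually_eq]
      intro t₀
      obtain ⟨U, hU, ht₀, c, hc⟩ := ha t₀
      -- The projection to `F` is defined on all of `ρ ⁻¹' U` and restricts to `fiberToModel` on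
      -- each fiber, so `U` need not be connected here.
      let q : C(ρ ⁻¹' U, F) := ⟨fun y => (Φ y.1).2, by fun_prop⟩
      have key : ∀ t ∈ U, push j (fiberToModel ρ Φ t) (a t) = push j q c := by
        intro t ht
        rw [← hc t ht, push_push]
        rfl
      filter_upwards [hU.mem_nhds ht₀] with t ht
      rw [key t ht, key t₀ ht₀]
    refine ⟨push j (fiberToModel ρ Φ 0) (a 0), fun t => ?_⟩
    rw [hloc.apply_eq_of_preconnectedSpace 0 t, push_push, modelToFiber_comp_fiberToModel, push_id]
  · rintro ⟨b, hb⟩ t₀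
    have := isPathConnected_iff_pathConnectedSpace.1
      ((convex_Icc (0 : ℝ) 1).isPathConnected ⟨0, by simp⟩)
    -- One neighborhood, the whole interval, suffices: any two fiber inclusions of `F` are homotopic
    -- in `Y`.
    refine ⟨Set.univ, isOpen_univ, trivial, push j (fiberIncl ρ Set.univ t₀ trivial) (a t₀),
      fun t ht => ?_⟩
    rw [hb, hb, push_push, push_push, push_congr j (homotopic_fiberIncl_comp_modelToFiber Φ hΦ
      (joinedIn_univ.2 (PathConnectedSpace.joined t t₀)))]

include hΦ in
/-- The sections of the cohomology local system of a trivialized family are the constant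
families. -/
lemma isCohomologySection_iff (j : ℕ) (a : ∀ t : I, coH j (Fiber ρ t)) :
    IsCohomologySection ρ j a ↔
      ∃ b : coH j F, ∀ t, a t = pull j (fiberToModel ρ Φ t) b := by
  constructor
  · intro ha
    have hloc : IsLocallyConstant fun t => pull j (modelToFiber Φ hΦ t) (a t) := by
      rw [IsLocallyConstant.iff_eventually_eq]
      intro t₀
      obtain ⟨U, hU, ht₀, c, hc⟩ := ha t₀
      -- A class over a disconnected `U` may restrict differently on different components; in a ball
      -- around `t₀` the two inclusions of `F` are homotopic inside `ρ ⁻¹' U`.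
      obtain ⟨ε, hε, hεU⟩ := Metric.isOpen_iff.1 hU t₀ ht₀
      filter_upwards [Metric.ball_mem_nhds t₀ hε] with t htε
      have ht : JoinedIn U t₀ t := joinedIn_of_ball_subset hεU htε
      rw [hc t ht.target_mem, hc t₀ ht₀, pull_pull, pull_pull,
        pull_congr j (homotopic_fiberIncl_comp_modelToFiber Φ hΦ ht)]
    refine ⟨pull j (modelToFiber Φ hΦ 0) (a 0), fun t => ?_⟩
    rw [hloc.apply_eq_of_preconnectedSpace 0 t, pull_pull, modelToFiber_comp_fiberToModel, pull_id]
  · rintro ⟨b, hb⟩ t₀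
    let q : C(ρ ⁻¹' Set.univ, F) := ⟨fun y => (Φ y.1).2, by fun_prop⟩
    refine ⟨Set.univ, isOpen_univ, trivial, pull j q b, fun t ht => ?_⟩
    rw [hb, pull_pull]
    rfl

end Trivialized

end Monodromy

/-! ### Gluing trivializations over the unit interval -/

/-- A map to the unit interval which is locally trivial with a fixed fiber is trivial. -/
lemma exists_trivialization_baseSet_eq_univ {F Z : Type*} [TopologicalSpace F]
    [TopologicalSpace Z] {proj : Z → I}
    (h : ∀ t, ∃ e : Bundle.Trivialization F proj, t ∈ e.baseSet) :
    ∃ e : Bundle.Trivialization F proj, e.baseSet = Set.univ := by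
  choose e he using h
  obtain ⟨t, h0, ht, ⟨m, hm⟩, hcov⟩ := exists_monotone_Icc_subset_open_cover_unitInterval
    (fun i => (e i).open_baseSet) (fun i _ => Set.mem_iUnion.2 ⟨i, he i⟩)
  have key : ∀ n, ∃ e : Bundle.Trivialization F proj, Set.Icc 0 (t n) ⊆ e.baseSet := by
    intro n
    induction n with
    | zero => exact ⟨e 0, by simpa [h0] using he 0⟩
    | succ n ih =>
      obtain ⟨e₁, h₁⟩ := ih
      obtain ⟨i, hi⟩ := hcov n
      -- Beyond `t n`, the trivialization `e i` is corrected by the coordinate change over that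
      -- point, so that it agrees with `e₁` there.
      refine ⟨e₁.piecewiseLe (e i) (t n) (h₁ ⟨nonneg', le_rfl⟩)
        (hi ⟨le_rfl, ht n.le_succ⟩), Set.subset_ite.2 ?_⟩
      exact ⟨fun x hx => h₁ ⟨hx.1.1, hx.2⟩, fun x hx => hi ⟨(not_le.1 hx.2).le, hx.1.2⟩⟩
  obtain ⟨e', he'⟩ := key m
  refine ⟨e', Set.eq_univ_of_forall fun x => he' ⟨nonneg', ?_⟩⟩
  rw [hm m le_rfl]
  exact le_one'

namespace Monodromy

/-! ### Comparison of geometric and local system monodromy -/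

section GeometricMonodromy

variable {X : Type u} {S : Type v} [TopologicalSpace X] [TopologicalSpace S]
  {f : X → S} {s : S} {γ : Path s s}

/-- The map induced on homology by a geometric monodromy is the local system monodromy. -/
lemma isHomologyMonodromy_pushEquiv {g : Fiber f s ≃ₜ Fiber f s} (hg : IsGeometricMonodromy f γ g)
    (j : ℕ) : IsHomologyMonodromy f γ j (pushEquiv j g) := by
  obtain ⟨F, _, Φ, hΦ, hΦg⟩ := hg
  intro x x'
  have e : (fiberToModel (proj f γ) Φ 1).comp
        ((identOne f γ : C(Fiber f s, Fiber (proj f γ) 1)).comp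
        (g : C(Fiber f s, Fiber f s))) =
      (fiberToModel (proj f γ) Φ 0).comp (identZero f γ : C(Fiber f s, Fiber (proj f γ) 0)) :=
    ContinuousMap.ext hΦg
  change push j (g : C(Fiber f s, Fiber f s)) x = x' ↔ _
  simp only [isHomologySection_iff Φ hΦ]
  constructor
  · rintro rfl
    refine ⟨fun t => push j (modelToFiber Φ hΦ t) (push j (fiberToModel (proj f γ) Φ 0)
      (push j (identZero f γ : C(Fiber f s, Fiber (proj f γ) 0)) x)), ⟨_, fun t => rfl⟩, ?_, ?_⟩
    · beta_reduce
      rw [push_push j (modelToFiber Φ hΦ 0), modelToFiber_comp_fiberToModel, push_id]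
    · beta_reduce
      rw [push_push j (fiberToModel _ _ _), ← e, push_push, push_push, ← ContinuousMap.comp_assoc,
        modelToFiber_comp_fiberToModel, ContinuousMap.id_comp]
  · rintro ⟨a, ⟨b, hb⟩, h0, h1⟩
    -- The constant value `b` is determined at 0, so the section's value at 1 is determined by `x`.
    have hb0 : b = push j (fiberToModel (proj f γ) Φ 0) (a 0) := by
      rw [hb, push_push, fiberToModel_comp_modelToFiber, push_id]
    apply (pushEquiv j (identOne f γ)).injective
    change push j (identOne f γ : C(Fiber f s, Fiber (proj f γ) 1)) _ =
      push j (identOne f γ : C(Fiber f s, Fiber (proj f γ) 1)) _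
    rw [← h1, hb, hb0, h0, push_push j (fiberToModel _ _ _), ← e, push_push, push_push,
      ← ContinuousMap.comp_assoc, modelToFiber_comp_fiberToModel, ContinuousMap.id_comp]

/-- The map induced on cohomology by a geometric monodromy is the inverse of the local system
monodromy. -/
lemma isCohomologyMonodromy_pullEquiv_symm {g : Fiber f s ≃ₜ Fiber f s} (hg : IsGeometricMonodromy f γ g)
    (j : ℕ) : IsCohomologyMonodromy f γ j (pullEquiv j g).symm := by
  obtain ⟨F, _, Φ, hΦ, hΦg⟩ := hg
  intro x x'
  have e : ((fiberToModel (proj f γ) Φ 1).comp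
        (identOne f γ : C(Fiber f s, Fiber (proj f γ) 1))).comp
        (g : C(Fiber f s, Fiber f s)) =
      (fiberToModel (proj f γ) Φ 0).comp (identZero f γ : C(Fiber f s, Fiber (proj f γ) 0)) :=
    ContinuousMap.ext hΦg
  rw [LinearEquiv.symm_apply_eq]
  change x = pull j (g : C(Fiber f s, Fiber f s)) x' ↔ _
  simp only [isCohomologySection_iff Φ hΦ]
  constructor
  · rintro rfl
    -- This constant section is chosen to end at `x'`; by `e` it starts at $g^*x'$, which accounts
    -- for the inverse in cohomology.
    let b := pull j (((identOne f γ).symm : C(Fiber (proj f γ) 1, Fiber f s)).comp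
      (modelToFiber Φ hΦ 1)) x'
    have hb : pull j (identOne f γ : C(Fiber f s, Fiber (proj f γ) 1))
        (pull j (fiberToModel (proj f γ) Φ 1) b) = x' := by
      rw [pull_pull j (fiberToModel _ _ _), ContinuousMap.comp_assoc,
        modelToFiber_comp_fiberToModel, ContinuousMap.comp_id, pull_pull]
      simp [pull_id]
    refine ⟨fun t => pull j (fiberToModel (proj f γ) Φ t) b, ⟨b, fun t => rfl⟩, ?_, hb⟩
    rw [pull_pull, ← e, ← pull_pull, ← pull_pull, hb]
  · rintro ⟨a, ⟨b, hb⟩, rfl, rfl⟩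
    rw [hb, hb, pull_pull, ← e, ← pull_pull, ← pull_pull]

end GeometricMonodromy

/-! ### Triviality of the base change and existence of a geometric monodromy -/

section BaseChange

variable {X : Type u} {S : Type v} [TopologicalSpace X] [TopologicalSpace S]
  {f : X → S} {s : S} (γ : Path s s)

/-- The fibers over the points of a loop are homeomorphic. -/
lemma nonempty_fiber_homeomorph (hloc : IsLocallyTrivial f) (t t' : I) :
    Nonempty (Fiber f (γ t) ≃ₜ Fiber f (γ t')) := by
  -- Having homeomorphic fibers is an equivalence relation that holds near each parameter, and
  -- $[0,1]$ is connected.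
  refine isPreconnected_univ.induction₂ (fun t t' => Nonempty (Fiber f (γ t) ≃ₜ Fiber f (γ t')))
    (fun t _ => ?_) (fun x y z _ _ _ ⟨h⟩ ⟨h'⟩ => ⟨h.trans h'⟩) (fun x y _ _ ⟨h⟩ => ⟨h.symm⟩)
    trivial trivial
  obtain ⟨e, he⟩ := hloc (γ t)
  rw [nhdsWithin_univ]
  filter_upwards [γ.continuous.continuousAt (e.open_baseSet.mem_nhds he)] with t' ht'
  exact ⟨(e.preimageSingletonHomeomorph ht').symm⟩

open scoped Classical in
/-- The base change of a trivialization by a loop. -/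
def baseChangeTrivialization {F : Type u} [TopologicalSpace F]
    (e : Bundle.Trivialization F f) (t₀ : I) (h₀ : γ t₀ ∈ e.baseSet) :
    Bundle.Trivialization F (proj f γ) where
  toFun y := (y.1.1, (e y.1.2).2)
  -- The inverse must be total with values in the fiber product. Off the base set, the parameter
  -- `t₀` supplies a default point that satisfies the defining equation.
  invFun p := if h : γ p.1 ∈ e.baseSet then
      ⟨(p.1, e.toOpenPartialHomeomorph.symm (γ p.1, p.2)), (e.proj_symm_apply' h).symm⟩
    else ⟨(t₀, e.toOpenPartialHomeomorph.symm (γ t₀, p.2)), (e.proj_symm_apply' h₀).symm⟩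
  source := {y | γ y.1.1 ∈ e.baseSet}
  target := (γ ⁻¹' e.baseSet) ×ˢ Set.univ
  map_source' y hy := ⟨hy, trivial⟩
  map_target' p hp := by
    have h : γ p.1 ∈ e.baseSet := hp.1
    simp [h]
  left_inv' y hy := by
    have h : γ y.1.1 ∈ e.baseSet := hy
    have h' : f y.1.2 ∈ e.baseSet := y.2 ▸ h
    rw [dif_pos h]
    refine Subtype.ext (Prod.ext rfl ?_)
    change e.toOpenPartialHomeomorph.symm (γ y.1.1, (e y.1.2).2) = y.1.2
    rw [y.2]
    exact e.symm_apply_mk_proj (e.mem_source.2 h')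
  right_inv' p hp := by
    have h : γ p.1 ∈ e.baseSet := hp.1
    rw [dif_pos h]
    refine Prod.ext rfl ?_
    change (e (e.toOpenPartialHomeomorph.symm (γ p.1, p.2))).2 = p.2
    rw [e.apply_symm_apply' h]
  open_source := e.open_baseSet.preimage (by fun_prop)
  open_target := (e.open_baseSet.preimage γ.continuous).prod isOpen_univ
  continuousOn_toFun := by
    refine ContinuousOn.prodMk (by fun_prop) (continuous_snd.comp_continuousOn ?_)
    refine e.continuousOn_toFun.comp (by fun_prop) fun y hy => ?_
    exact e.mem_source.2 (y.2 ▸ hy)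
  continuousOn_invFun := by
    -- Continuity is tested in `I × X`, where the inverse agrees on the target with a formula free
    -- of the case distinction.
    refine IsInducing.subtypeVal.continuousOn_iff.2 ?_
    refine ContinuousOn.congr (f := fun p : I × F =>
      (p.1, e.toOpenPartialHomeomorph.symm (γ p.1, p.2))) ?_ fun p hp => ?_
    · refine ContinuousOn.prodMk (by fun_prop) ?_
      refine e.continuousOn_invFun.comp (by fun_prop) fun p hp => ?_
      exact e.mem_target.2 hp.1
    · have h : γ p.1 ∈ e.baseSet := hp.1
      simp [h]
  baseSet := γ ⁻¹' e.baseSet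
  open_baseSet := e.open_baseSet.preimage γ.continuous
  source_eq := rfl
  target_eq := rfl
  proj_toFun y hy := rfl

/-- A locally trivial map becomes trivial after base change by a loop. -/
lemma exists_baseChange_homeomorph (hloc : IsLocallyTrivial f) :
    ∃ Φ : BaseChange f γ ≃ₜ I × Fiber f (γ 0), ∀ y, (Φ y).1 = proj f γ y := by
  have h (t : I) : ∃ e : Bundle.Trivialization (Fiber f (γ 0)) (proj f γ), t ∈ e.baseSet := by
    obtain ⟨e, he⟩ := hloc (γ t)
    -- Local triviality has a model fiber varying with `t`; gluing needs a common one.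
    obtain ⟨k⟩ := nonempty_fiber_homeomorph γ hloc t 0
    exact ⟨(baseChangeTrivialization γ e t he).transFiberHomeomorph k, he⟩
  obtain ⟨e, he⟩ := exists_trivialization_baseSet_eq_univ h
  have hs : e.source = Set.univ := by rw [e.source_eq, he, Set.preimage_univ]
  have ht : e.target = Set.univ := by rw [e.target_eq, he, Set.univ_prod_univ]
  exact ⟨e.toOpenPartialHomeomorph.toHomeomorphOfSourceEqUnivTargetEqUniv hs ht,
    fun y => e.coe_fst (hs ▸ trivial)⟩

/-- A global trivialization identifies both $Y_0$ and $Y_1$ with the same model; one identification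
followed by the inverse of the other is the monodromy. -/
lemma exists_isGeometricMonodromy (hloc : IsLocallyTrivial f) :
    ∃ g, IsGeometricMonodromy f γ g := by
  obtain ⟨Φ, hΦ⟩ := exists_baseChange_homeomorph γ hloc
  let k (t : I) : Fiber (proj f γ) t ≃ₜ Fiber f (γ 0) :=
    { toFun := fiberToModel (proj f γ) Φ t
      invFun := modelToFiber Φ hΦ t
      left_inv := fun y => DFunLike.congr_fun (modelToFiber_comp_fiberToModel Φ hΦ t) y
      right_inv := fun y => DFunLike.congr_fun (fiberToModel_comp_modelToFiber Φ hΦ t) y }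
  refine ⟨((identZero f γ).trans (k 0)).trans ((identOne f γ).trans (k 1)).symm,
    Fiber f (γ 0), inferInstance, Φ, hΦ, fun x => ?_⟩
  exact ((identOne f γ).trans (k 1)).apply_symm_apply (((identZero f γ).trans (k 0)) x)

end BaseChange

end Monodromy

end

theorem mainTheorem3 {X : Type u} {S : Type v} [TopologicalSpace X] [TopologicalSpace S]
    (f : X → S) (hf : Continuous f) (hloc : Monodromy.IsLocallyTrivial f)
    (hfinH : ∀ (t : S) (j : ℕ), FiniteDimensional ℚ (Monodromy.H j (Monodromy.Fiber f t)))
    (hfinC : ∀ (t : S) (j : ℕ), FiniteDimensional ℚ (Monodromy.coH j (Monodromy.Fiber f t)))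
    (s : S) (γ : Path s s) :
    (∃ g, Monodromy.IsGeometricMonodromy f γ g) ∧
    ∀ j : ℕ,
      (Monodromy.pairing j (Monodromy.Fiber f s)).IsPerfPair ∧
      ∃ (γh : Monodromy.H j (Monodromy.Fiber f s) ≃ₗ[ℚ] Monodromy.H j (Monodromy.Fiber f s))
        (γc : Monodromy.coH j (Monodromy.Fiber f s) ≃ₗ[ℚ] Monodromy.coH j (Monodromy.Fiber f s)),
        Monodromy.IsHomologyMonodromy f γ j γh ∧
        Monodromy.IsCohomologyMonodromy f γ j γc ∧
        (∀ x y, Monodromy.pairing j (Monodromy.Fiber f s) (γc x) (γh y) =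
          Monodromy.pairing j (Monodromy.Fiber f s) x y) ∧
        ∀ g : Monodromy.Fiber f s ≃ₜ Monodromy.Fiber f s, Monodromy.IsGeometricMonodromy f γ g →
          Monodromy.push j (g : C(Monodromy.Fiber f s, Monodromy.Fiber f s)) = γh ∧
          Monodromy.pull j (g : C(Monodromy.Fiber f s, Monodromy.Fiber f s)) = γc.symm ∧
          ∀ x y,
            Monodromy.pairing j (Monodromy.Fiber f s)
              (Monodromy.pull j (g : C(Monodromy.Fiber f s, Monodromy.Fiber f s)) x) y =
            Monodromy.pairing j (Monodromy.Fiber f s) x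
              (Monodromy.push j (g : C(Monodromy.Fiber f s, Monodromy.Fiber f s)) y) := by
  obtain ⟨g, hg⟩ := Monodromy.exists_isGeometricMonodromy γ hloc
  refine ⟨⟨g, hg⟩, fun j => ⟨?_, Monodromy.pushEquiv j g, (Monodromy.pullEquiv j g).symm,
    Monodromy.isHomologyMonodromy_pushEquiv hg j,
    Monodromy.isCohomologyMonodromy_pullEquiv_symm hg j, fun x y => ?_, fun g' hg' => ⟨?_, ?_, ?_⟩⟩⟩
  · have := hfinH s j
    exact LinearMap.IsPerfPair.of_bijective _
      ⟨Monodromy.pairing_injective j _, Monodromy.pairing_surjective j _⟩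
  · exact Monodromy.pairing_pullEquiv_symm_pushEquiv j g x y
  -- The homology maps of `g` and `g'` have the same graph, described by sections without reference
  -- to a trivialization. The cohomology case below is the same argument for the inverses.
  · refine LinearMap.ext fun x => ?_
    exact ((Monodromy.isHomologyMonodromy_pushEquiv hg j x _).2
      ((Monodromy.isHomologyMonodromy_pushEquiv hg' j x _).1 rfl)).symm
  · refine LinearMap.ext fun x => ?_
    rw [LinearEquiv.symm_symm]
    change Monodromy.pullEquiv j g' x = Monodromy.pullEquiv j g x
    rw [← LinearEquiv.symm_apply_eq]
    exact (Monodromy.isCohomologyMonodromy_pullEquiv_symm hg j _ x).2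
      ((Monodromy.isCohomologyMonodromy_pullEquiv_symm hg' j _ x).1
        ((Monodromy.pullEquiv j g').symm_apply_apply x))
  · exact Monodromy.pairing_pull j _
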